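/- A \emph{planar network of order $n$} is a finite directed acyclic graph $G$ (parallel edges allowed) with $2n$ distinguished vertices, the sources $s_1,\dots,s_n$ (which no edge enters) and the sinks $t_1,\dots,t_n$ (which no edge leaves), that can be drawn in a vertical strip of the plane so that distinct edges do not meet at points other than vertices, the sources lie on the left side of the strip in the order $s_1,\dots,s_n$ from top to bottom, and the sinks lie on the right side in the order $t_1,\dots,t_n$ from top to bottom. Every edge has a positive real weight; the weight of a path is the product of the weights of its edges, and the weight of a family of paths is the product of the weights of its members. The \emph{weight matrix} of $G$ is the $n\times n$ matrix whose $(i,j)$ entry is the sum of the weights of all paths from $s_i$ to $t_j$. A real square matrix is \emph{totally nonnegative} if all its minors are nonnegative, where the minor $\Delta_{I,J}$ is the determinant of the submatrix with row set $I$ and column set $J$, $|I|=|J|$, and $\Delta_{\emptyset,\emptyset}=1$. Let $A$ be a totally nonnegative $n\times n$ matrix, let $G$ be a planar network of order $n$ whose weight matrix is $A$, let $I\subseteq[n]=\{1,\dots,n\}$ and let $\overline I=[n]\setminus I$. Then the product $\Delta_{I,I}\,\Delta_{\overline I,\overline I}$ of minors of $A$ is equal to the sum of the weights of all families $\pi=(\pi_1,\dots,\pi_n)$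 of paths in $G$ such that 1. $\pi_i$ is a path from $s_i$ to $t_i$ for every $i\in[n]$; 2. the paths $\pi_i$ with $i\in I$ are pairwise vertex-disjoint, and the paths $\pi_i$ with $i\in\overline I$ are pairwise vertex-disjoint. -/

import Mathlib

/-- The minor `Δ_{I,J} = det A_{I,J}` of `A`, for row and column sets of equal size; the chosen rows
and columns are listed in increasing order. The empty minor is `1`. -/
def minor {n : ℕ} (A : Matrix (Fin n) (Fin n) ℝ) (I J : Finset (Fin n)) (h : I.card = J.card) : ℝ :=
  (A.submatrix (I.orderEmbOfFin rfl) (J.orderEmbOfFin h.symm)).det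

/-- A square real matrix is totally nonnegative if all its minors are nonnegative. -/
def IsTotallyNonneg {n : ℕ} (A : Matrix (Fin n) (Fin n) ℝ) : Prop :=
  ∀ (I J : Finset (Fin n)) (h : I.card = J.card), 0 ≤ minor A I J h

/-- A drawing, without crossings, of a directed (multi)graph `V` with distinguished vertices
`s 0, …, s (n-1)` and `t 0, …, t (n-1)`: vertices are distinct points of the vertical strip
`0 ≤ x ≤ 1`, edges are simple arcs in that strip, two different edges meet only at vertices,
no edge passes through a vertex other than its endpoints, the `s i` lie on the left side of the
strip and the `t i` on its right side, both labelled from top to bottom. -/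
structure StripDrawing (V : Type*) [Quiver V] {n : ℕ} (s t : Fin n → V) where
  /-- the position of a vertex -/
  pos : V → ℝ × ℝ
  /-- the arc that represents an edge -/
  arc : ∀ e : Quiver.Total V, _root_.Path (pos e.left) (pos e.right)
  pos_injective : Function.Injective pos
  arc_injective : ∀ e, Function.Injective (arc e)
  /-- an edge contains no vertices besides its endpoints -/
  arc_eq_pos : ∀ e x v, arc e x = pos v → x = 0 ∨ x = 1
  /-- different edges do not meet at points other than vertices -/
  arc_inter : ∀ e f, e ≠ f → ∀ x y, arc e x = arc f y → ∃ v, arc e x = pos v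
  pos_mem_strip : ∀ v, (pos v).1 ∈ Set.Icc (0 : ℝ) 1
  arc_mem_strip : ∀ e x, (arc e x).1 ∈ Set.Icc (0 : ℝ) 1
  source_left : ∀ i, (pos (s i)).1 = 0
  sink_right : ∀ i, (pos (t i)).1 = 1
  source_order : ∀ i j, i < j → (pos (s j)).2 < (pos (s i)).2
  sink_order : ∀ i j, i < j → (pos (t j)).2 < (pos (t i)).2

/-- A planar network of order `n` with positive real edge weights, whose underlying directed
(multi)graph is the quiver `V`. -/
structure PlanarNetwork (V : Type*) [Quiver V] (n : ℕ) where
  /-- the sources `s_1, …, s_n` -/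
  source : Fin n → V
  /-- the sinks `t_1, …, t_n` -/
  sink : Fin n → V
  /-- the weight of an edge -/
  edgeWeight : ∀ {u v : V}, (u ⟶ v) → ℝ
  edgeWeight_pos : ∀ {u v : V} (e : u ⟶ v), 0 < edgeWeight e
  /-- there are no directed cycles -/
  acyclic : ∀ (v : V) (p : Quiver.Path v v), p = Quiver.Path.nil
  /-- no edge enters a source -/
  source_no_in : ∀ i u, IsEmpty (u ⟶ source i)
  /-- no edge leaves a sink -/
  sink_no_out : ∀ i v, IsEmpty (sink i ⟶ v)
  /-- the graph can be drawn without crossings -/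
  planar : Nonempty (StripDrawing V source sink)

namespace PlanarNetwork

variable {V : Type*} [Quiver V] {n : ℕ}

/-- The weight of a path: the product of the weights of its edges. -/
def pathWeight (G : PlanarNetwork V n) {u v : V} (p : Quiver.Path u v) : ℝ :=
  p.weight G.edgeWeight

/-- The weight matrix: its entry `i j` is the sum of the weights of all paths from `s_i` to `t_j`
(a finite sum, by `finite_path`, when the graph is finite). -/
noncomputable def weightMatrix (G : PlanarNetwork V n) : Matrix (Fin n) (Fin n) ℝ :=
  Matrix.of fun i j => ∑ᶠ p : Quiver.Path (G.source i) (G.sink j), G.pathWeight p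

/-- Families `π = (π_1, …, π_n)` in which `π_i` is a path from `s_i` to `t_i`. -/
abbrev PathFamily (G : PlanarNetwork V n) : Type _ :=
  ∀ i : Fin n, Quiver.Path (G.source i) (G.sink i)

/-- The weight of a family of paths: the product of the weights of its members. -/
def familyWeight (G : PlanarNetwork V n) (π : G.PathFamily) : ℝ :=
  ∏ i, G.pathWeight (π i)

/-- The paths of the family with indices in `I` are pairwise disjoint: no vertex lies on two of
them. -/
def DisjointOn (G : PlanarNetwork V n) (π : G.PathFamily) (I : Finset (Fin n)) : Prop :=
  ∀ i ∈ I, ∀ j ∈ I, i ≠ j → ∀ v, v ∈ (π i).vertices → v ∉ (π j).vertices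

/-- A finite network has finitely many paths between two given vertices. -/
theorem finite_path [Finite V] [∀ u v : V, Finite (u ⟶ v)] (G : PlanarNetwork V n) (u v : V) :
    Finite (Quiver.Path u v) := by
  let r : V → V → Prop := fun a b => ∃ p : Quiver.Path a b, 0 < p.length
  have : IsTrans V r := ⟨fun a b c ⟨p, hp⟩ ⟨q, _⟩ =>
    ⟨p.comp q, by rw [Quiver.Path.length_comp]; omega⟩⟩
  have : Std.Irrefl r := ⟨fun a ⟨p, hp⟩ => by rw [G.acyclic a p] at hp; simp at hp⟩
  have wf : WellFounded r := Finite.wellFounded_of_trans_of_irrefl r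
  induction v using wf.induction with
  | _ v ih =>
    have : ∀ w, Finite (Quiver.Path u w × (w ⟶ v)) := by
      intro w
      rcases isEmpty_or_nonempty (w ⟶ v) with h | ⟨⟨e⟩⟩
      · infer_instance
      · have := ih w ⟨e.toPath, by simp⟩
        infer_instance
    let g : {_x : Unit // u = v} ⊕ (Σ w, Quiver.Path u w × (w ⟶ v)) → Quiver.Path u v :=
      fun x => match x with
        | Sum.inl h => h.2 ▸ Quiver.Path.nil
        | Sum.inr y => y.2.1.cons y.2.2
    refine Finite.of_surjective g ?_
    intro p
    cases p with
    | nil => exact ⟨Sum.inl ⟨(), rfl⟩, rfl⟩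
    | cons p e => exact ⟨Sum.inr ⟨_, p, e⟩, rfl⟩

/-- A finite network has finitely many families of paths from `s_i` to `t_i`. -/
theorem finite_pathFamily [Finite V] [∀ u v : V, Finite (u ⟶ v)] (G : PlanarNetwork V n) :
    Finite G.PathFamily := by
  have : ∀ u v : V, Finite (Quiver.Path u v) := G.finite_path
  infer_instance

end PlanarNetwork

/-! A family indexed by `[n]` is the same as a pair of families indexed by `I` and by its
complement, and its weight is the product of the two weights. So it suffices that each principal
minor is the sum of the weights of the vertex-disjoint families joining each source to the sink of
the same index.

This is the Lindström–Gessel–Viennot lemma `Quiver.Path.det_sum_weight_eq` together with planarity.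
Multilinearity expands the determinant into a signed sum over all families starting at the given
sources. Exchanging two tails at a shared vertex is a weight-preserving, sign-reversing involution
on the families that are not disjoint, so only disjoint ones survive. Planarity
(`exists_common_vertex`) forces a disjoint family to preserve the order of its endpoints, hence to
be the identity matching, whose sign is `1`.

The topological input is `Path.exists_eq_of_crossing`. If the curves did not meet, the difference of
their points would have a continuous argument over the parameter square; following it along the two
boundary routes between opposite corners gives a contradiction. -/

/-! ### Crossing curves in a strip -/

/-- A continuous function that takes the value `π / 2` at `0` and whose cosine is nonnegative stays
below `π / 2`. -/
theorem le_pi_div_two_of_cos_nonneg {g : ℝ → ℝ} (hg : Continuous g) (h0 : g 0 = Real.pi / 2)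
    (hc : ∀ r, 0 ≤ Real.cos (g r)) (r : ℝ) : g r ≤ Real.pi / 2 := by
  by_contra! h
  have hpi := Real.pi_pos
  -- Capping at `π` keeps the intermediate value in `(π / 2, π]`, where the cosine is negative.
  have hm : min (g r) Real.pi ∈ Set.uIcc (g 0) (g r) := by
    rw [h0, Set.uIcc_of_le h.le]
    exact ⟨le_min h.le (by linarith), min_le_left _ _⟩
  obtain ⟨x, -, hx⟩ := intermediate_value_uIcc hg.continuousOn hm
  have hneg : Real.cos (g x) < 0 := by
    rw [hx]
    exact Real.cos_neg_of_pi_div_two_lt_of_lt (lt_min h (by linarith))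
      ((min_le_right _ _).trans_lt (by linarith))
  exact (hc x).not_gt hneg

/-- A continuous function that takes the value `π / 2` at `0` and whose cosine is nonpositive stays
above `π / 2`. -/
theorem pi_div_two_le_of_cos_nonpos {g : ℝ → ℝ} (hg : Continuous g) (h0 : g 0 = Real.pi / 2)
    (hc : ∀ r, Real.cos (g r) ≤ 0) (r : ℝ) : Real.pi / 2 ≤ g r := by
  have := le_pi_div_two_of_cos_nonneg (g := fun r => Real.pi - g r) (by fun_prop)
    (by rw [h0]; ring) (fun r => by rw [Real.cos_pi_sub]; linarith [hc r]) r
  linarith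

/-- A nowhere vanishing planar vector field on a simply connected space has a continuous argument,
with a prescribed value at one point. -/
theorem exists_continuous_arg {X : Type*} [TopologicalSpace X] [SimplyConnectedSpace X]
    [LocallyPathConnectedSpace X] (F : X → ℂ) (hF : Continuous F) (h0 : ∀ x, F x ≠ 0) (a : X)
    (θ₀ : ℝ) (hθ₀ : F a = ‖F a‖ * Complex.exp (θ₀ * Complex.I)) :
    ∃ θ : X → ℝ, Continuous θ ∧ θ a = θ₀ ∧
      ∀ x, F x = ‖F x‖ * Complex.exp (θ x * Complex.I) := by
  have hn : ∀ x, (‖F x‖ : ℂ) ≠ 0 := fun x => by simpa using h0 x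
  let f : C(X, Circle) :=
    ⟨fun x => ⟨F x / ‖F x‖, mem_sphere_zero_iff_norm.2 (by simp [h0 x])⟩,
      Continuous.subtype_mk (hF.div (by fun_prop) hn) _⟩
  have hf : ∀ x (t : ℝ), Circle.exp t = f x ↔ F x = ‖F x‖ * Complex.exp (t * Complex.I) := by
    intro x t
    rw [Circle.ext_iff, Circle.coe_exp]
    change _ = F x / ‖F x‖ ↔ _
    rw [eq_div_iff (hn x), mul_comm, eq_comm]
  obtain ⟨θ, ⟨h1, h2⟩, -⟩ :=
    Circle.isCoveringMap_exp.existsUnique_continuousMap_lifts f a θ₀ ((hf a θ₀).2 hθ₀)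
  exact ⟨θ, θ.continuous, h1, fun x => (hf x (θ x)).1 (congrFun h2 x)⟩

/-- Two curves in the strip `0 ≤ x ≤ 1` that connect its sides, and whose endpoints are in
opposite orders on the two sides, intersect. -/
theorem Path.exists_eq_of_crossing {p q p' q' : ℝ × ℝ} (γ : Path p q) (δ : Path p' q')
    (hγ : ∀ x, (γ x).1 ∈ Set.Icc (0 : ℝ) 1) (hδ : ∀ x, (δ x).1 ∈ Set.Icc (0 : ℝ) 1)
    (hp : p.1 = 0) (hp' : p'.1 = 0) (hq : q.1 = 1) (hq' : q'.1 = 1)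
    (hpp' : p'.2 < p.2) (hqq' : q.2 < q'.2) : ∃ x y, γ x = δ y := by
  by_contra! hne
  have hγ' : ∀ r, (γ.extend r).1 ∈ Set.Icc (0 : ℝ) 1 := fun r => hγ _
  have hδ' : ∀ r, (δ.extend r).1 ∈ Set.Icc (0 : ℝ) 1 := fun r => hδ _
  -- Extending the curves by constants makes the difference a field on the whole plane, which is
  -- simply connected.
  let F : ℝ × ℝ → ℂ := fun z =>
    ⟨(γ.extend z.1).1 - (δ.extend z.2).1, (γ.extend z.1).2 - (δ.extend z.2).2⟩
  have hFc : Continuous F := by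
    have : F = fun z => Complex.equivRealProdCLM.symm (γ.extend z.1 - δ.extend z.2) := rfl
    rw [this]
    fun_prop
  have hF0 : ∀ z, F z ≠ 0 := by
    intro z hz
    rw [Complex.ext_iff] at hz
    exact hne _ _ (Prod.ext (sub_eq_zero.1 hz.1) (sub_eq_zero.1 hz.2))
  have h00 : F (0, 0) = ((p.2 - p'.2 : ℝ) : ℂ) * Complex.I := by
    apply Complex.ext <;> simp [F, hp, hp']
  obtain ⟨θ, hθc, hθ0, hθ⟩ := exists_continuous_arg F hFc hF0 (0, 0) (Real.pi / 2) (by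
    rw [h00, norm_mul, Complex.norm_I, Complex.norm_real, Real.norm_of_nonneg (by linarith)]
    push_cast
    rw [Complex.exp_pi_div_two_mul_I]
    simp)
  have hre : ∀ z, (F z).re = ‖F z‖ * Real.cos (θ z) := fun z => by
    conv_lhs => rw [hθ z]
    rw [Complex.re_ofReal_mul, Complex.exp_ofReal_mul_I_re]
  have him : ∀ z, (F z).im = ‖F z‖ * Real.sin (θ z) := fun z => by
    conv_lhs => rw [hθ z]
    rw [Complex.im_ofReal_mul, Complex.exp_ofReal_mul_I_im]
  have hnorm : ∀ z, 0 < ‖F z‖ := fun z => norm_pos_iff.2 (hF0 z)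
  -- As `r` runs from `0` to `2`, the route goes from `(0, 0)` via `(0, 1)` to `(1, 1)`. On it `γ`
  -- is at its left end or `δ` at its right end, so `F` has nonpositive real part.
  have hlow : Real.pi / 2 ≤ θ (1, 1) := by
    have := pi_div_two_le_of_cos_nonpos (g := fun r => θ (max (r - 1) 0, min r 1)) (by fun_prop)
      (by simpa using hθ0) (fun r => ?_) 2
    · norm_num at this
      exact this
    · have h : (F (max (r - 1) 0, min r 1)).re ≤ 0 := by
        rcases le_total r 1 with hr | hr
        · simp only [F, max_eq_right (sub_nonpos.2 hr), γ.extend_zero, hp]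
          linarith [(hδ' (min r 1)).1]
        · simp only [F, min_eq_right hr, δ.extend_one, hq']
          linarith [(hγ' (max (r - 1) 0)).2]
      rw [hre] at h
      exact nonpos_of_mul_nonpos_right h (hnorm _)
  -- The other route, via `(1, 0)`, keeps the real part nonnegative.
  have hhigh : θ (1, 1) ≤ Real.pi / 2 := by
    have := le_pi_div_two_of_cos_nonneg (g := fun r => θ (min r 1, max (r - 1) 0)) (by fun_prop)
      (by simpa using hθ0) (fun r => ?_) 2
    · norm_num at this
      exact this
    · have h : 0 ≤ (F (min r 1, max (r - 1) 0)).re := by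
        rcases le_total r 1 with hr | hr
        · simp only [F, max_eq_right (sub_nonpos.2 hr), δ.extend_zero, hp']
          linarith [(hγ' (min r 1)).1]
        · simp only [F, min_eq_right hr, γ.extend_one, hq]
          linarith [(hδ' (max (r - 1) 0)).2]
      rw [hre] at h
      exact nonneg_of_mul_nonneg_right h (hnorm _)
  -- The argument at `(1, 1)` is `π / 2`, so `F` points upwards there, against the order of the
  -- right endpoints.
  have h11 := him (1, 1)
  have hF11 : (F (1, 1)).im = q.2 - q'.2 := by simp [F]
  rw [le_antisymm hhigh hlow, Real.sin_pi_div_two, mul_one, hF11] at h11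
  linarith [hnorm (1, 1)]

/-! ### Splicing paths in an acyclic quiver -/

namespace Quiver.Path

variable {V : Type*} [Quiver V]

theorem mem_vertices_comp {a b c : V} (p : Quiver.Path a b) (q : Quiver.Path b c) {w : V} :
    w ∈ (p.comp q).vertices ↔ w ∈ p.vertices ∨ w ∈ q.vertices := by
  induction q with
  | nil =>
    simp only [comp_nil, vertices_nil, List.mem_singleton]
    exact ⟨Or.inl, fun h => h.elim id fun h => h ▸ p.end_mem_vertices⟩
  | cons q e ih => rw [comp_cons, mem_vertices_cons, mem_vertices_cons, ih, or_assoc]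

/-- In an acyclic quiver, the decomposition of a path at a vertex is unique. -/
theorem comp_inj_of_acyclic (hV : ∀ (v : V) (p : Quiver.Path v v), p = nil) {a v b : V}
    {p p' : Quiver.Path a v} {q q' : Quiver.Path v b} (h : p.comp q = p'.comp q') :
    p = p' ∧ q = q' := by
  induction q with
  | nil =>
    obtain rfl := hV _ q'
    exact ⟨h, rfl⟩
  | cons q e ih =>
    cases q' with
    | nil => exact absurd (hV _ (q.cons e)) (cons_ne_nil q e)
    | cons q' e' =>
      rw [comp_cons, comp_cons] at h
      obtain rfl := obj_eq_of_cons_eq_cons h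
      obtain ⟨rfl, rfl⟩ := ih (eq_of_heq (heq_of_cons_eq_cons h))
      obtain rfl := eq_of_heq (hom_heq_of_cons_eq_cons h)
      exact ⟨rfl, rfl⟩

/-- In an acyclic quiver, a vertex lying before and after `v` is `v`. -/
theorem eq_of_mem_of_mem_of_acyclic (hV : ∀ (v : V) (p : Quiver.Path v v), p = nil) {a v b w : V}
    {p : Quiver.Path a v} {q : Quiver.Path v b} (hp : w ∈ p.vertices) (hq : w ∈ q.vertices) :
    w = v := by
  obtain ⟨-, p₂, -⟩ := p.exists_eq_comp_of_mem_vertices hp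
  obtain ⟨q₁, -, -⟩ := q.exists_eq_comp_of_mem_vertices hq
  exact (eq_of_length_zero q₁ (nil_of_comp_eq_nil_left (hV v (q₁.comp p₂)))).symm

variable {ι : Type*} {t : ι → V}

open Classical in
/-- The path that follows `x` up to the vertex `v` and `y` afterwards, and `x` itself if `v` does not
lie on both paths. -/
noncomputable def splice {a b : V} (x : Σ j, Quiver.Path a (t j)) (y : Σ j, Quiver.Path b (t j))
    (v : V) : Σ j, Quiver.Path a (t j) :=
  if h : v ∈ x.2.vertices ∧ v ∈ y.2.vertices then
    ⟨y.1, (x.2.exists_eq_comp_of_mem_vertices h.1).choose.comp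
      (y.2.exists_eq_comp_of_mem_vertices h.2).choose_spec.choose⟩
  else x

/-- Uniqueness of decompositions makes the choices in `splice` irrelevant; the properties of
splicing at a common vertex reduce to this formula. -/
theorem splice_comp (hV : ∀ (v : V) (p : Quiver.Path v v), p = nil) {a b v : V} {j k : ι}
    (p : Quiver.Path a v) (q : Quiver.Path v (t j)) (p' : Quiver.Path b v)
    (q' : Quiver.Path v (t k)) :
    splice ⟨j, p.comp q⟩ ⟨k, p'.comp q'⟩ v = ⟨k, p.comp q'⟩ := by
  have h : v ∈ (p.comp q).vertices ∧ v ∈ (p'.comp q').vertices :=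
    ⟨(mem_vertices_comp p q).2 (Or.inl p.end_mem_vertices),
      (mem_vertices_comp p' q').2 (Or.inl p'.end_mem_vertices)⟩
  have h₁ := comp_inj_of_acyclic hV
    ((p.comp q).exists_eq_comp_of_mem_vertices h.1).choose_spec.choose_spec
  have h₂ := comp_inj_of_acyclic hV
    ((p'.comp q').exists_eq_comp_of_mem_vertices h.2).choose_spec.choose_spec
  rw [splice, dif_pos h]
  dsimp only
  rw [← h₁.1, ← h₂.2]

theorem splice_of_notMem {a b : V} {x : Σ j, Quiver.Path a (t j)} {y : Σ j, Quiver.Path b (t j)}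
    {v : V} (h : v ∉ x.2.vertices) : splice x y v = x :=
  dif_neg fun h' => h h'.1

theorem exists_decomposition {a v : V} {x : Σ j, Quiver.Path a (t j)} (h : v ∈ x.2.vertices) :
    ∃ (j : ι) (p : Quiver.Path a v) (q : Quiver.Path v (t j)), x = ⟨j, p.comp q⟩ := by
  obtain ⟨j, x⟩ := x
  obtain ⟨p, q, rfl⟩ := x.exists_eq_comp_of_mem_vertices h
  exact ⟨j, p, q, rfl⟩

section Splice

variable {a b v : V} {x : Σ j, Quiver.Path a (t j)} {y : Σ j, Quiver.Path b (t j)}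

/-- This lets `swapTails` use one formula for all indices: those other than `i` and `j` splice a
path with itself. -/
theorem splice_self (hV : ∀ (v : V) (p : Quiver.Path v v), p = nil) : splice x x v = x := by
  by_cases h : v ∈ x.2.vertices
  · obtain ⟨j, p, q, rfl⟩ := exists_decomposition h
    exact splice_comp hV p q p q
  · exact splice_of_notMem h

theorem splice_fst (hV : ∀ (v : V) (p : Quiver.Path v v), p = nil) (hx : v ∈ x.2.vertices)
    (hy : v ∈ y.2.vertices) : (splice x y v).1 = y.1 := by
  obtain ⟨j, p, q, rfl⟩ := exists_decomposition hx
  obtain ⟨k, p', q', rfl⟩ := exists_decomposition hy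
  rw [splice_comp hV]

theorem mem_splice (hV : ∀ (v : V) (p : Quiver.Path v v), p = nil) (hx : v ∈ x.2.vertices)
    (hy : v ∈ y.2.vertices) : v ∈ (splice x y v).2.vertices := by
  obtain ⟨j, p, q, rfl⟩ := exists_decomposition hx
  obtain ⟨k, p', q', rfl⟩ := exists_decomposition hy
  rw [splice_comp hV]
  exact (mem_vertices_comp p q').2 (Or.inl p.end_mem_vertices)

theorem splice_splice (hV : ∀ (v : V) (p : Quiver.Path v v), p = nil) (hx : v ∈ x.2.vertices)
    (hy : v ∈ y.2.vertices) : splice (splice x y v) (splice y x v) v = x := by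
  obtain ⟨j, p, q, rfl⟩ := exists_decomposition hx
  obtain ⟨k, p', q', rfl⟩ := exists_decomposition hy
  rw [splice_comp hV, splice_comp hV, splice_comp hV]

theorem mem_splice_or_mem_splice (hV : ∀ (v : V) (p : Quiver.Path v v), p = nil)
    (hx : v ∈ x.2.vertices) (hy : v ∈ y.2.vertices) {w : V}
    (hw : w ∈ x.2.vertices) :
    w ∈ (splice x y v).2.vertices ∨ w ∈ (splice y x v).2.vertices := by
  obtain ⟨j, p, q, rfl⟩ := exists_decomposition hx
  obtain ⟨k, p', q', rfl⟩ := exists_decomposition hy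
  rw [splice_comp hV, splice_comp hV, mem_vertices_comp, mem_vertices_comp]
  rw [mem_vertices_comp] at hw
  tauto

/-- By acyclicity, a common vertex other than `v` cannot precede `v` on one path and follow it on
the other. It lies in both initial parts or in both tails, and each new path contains one of each.
-/
theorem mem_splice_and_mem_splice (hV : ∀ (v : V) (p : Quiver.Path v v), p = nil)
    (hx : v ∈ x.2.vertices) (hy : v ∈ y.2.vertices) {w : V}
    (hwx : w ∈ x.2.vertices) (hwy : w ∈ y.2.vertices) :
    w ∈ (splice x y v).2.vertices ∧ w ∈ (splice y x v).2.vertices := by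
  by_cases hwv : w = v
  · subst hwv
    exact ⟨mem_splice hV hx hy, mem_splice hV hy hx⟩
  obtain ⟨j, p, q, rfl⟩ := exists_decomposition hx
  obtain ⟨k, p', q', rfl⟩ := exists_decomposition hy
  rw [splice_comp hV, splice_comp hV, mem_vertices_comp, mem_vertices_comp]
  rw [mem_vertices_comp] at hwx hwy
  have h₁ : ¬ (w ∈ p.vertices ∧ w ∈ q'.vertices) := fun h =>
    hwv (eq_of_mem_of_mem_of_acyclic hV h.1 h.2)
  have h₂ : ¬ (w ∈ p'.vertices ∧ w ∈ q.vertices) := fun h =>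
    hwv (eq_of_mem_of_mem_of_acyclic hV h.1 h.2)
  tauto

theorem weight_splice_mul (hV : ∀ (v : V) (p : Quiver.Path v v), p = nil) {R : Type*}
    [CommMonoid R] (w : ∀ {i j : V}, (i ⟶ j) → R) (hx : v ∈ x.2.vertices)
    (hy : v ∈ y.2.vertices) :
    (splice x y v).2.weight w * (splice y x v).2.weight w = x.2.weight w * y.2.weight w := by
  obtain ⟨j, p, q, rfl⟩ := exists_decomposition hx
  obtain ⟨k, p', q', rfl⟩ := exists_decomposition hy
  rw [splice_comp hV, splice_comp hV]
  simp only [weight_comp]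
  ac_rfl

end Splice

/-! ### Exchanging tails in a family of paths -/

variable {κ : Type*} {s : ι → V} {t : κ → V}

/-- Exchange the tails of the `i`-th and the `j`-th path at the vertex `v`. -/
noncomputable def swapTails [DecidableEq ι] (q : ∀ i, Σ j, Quiver.Path (s i) (t j)) (v : V)
    (i j : ι) : ∀ i, Σ j, Quiver.Path (s i) (t j) :=
  fun k => splice (q k) (q (Equiv.swap i j k)) v

/-- The paths `q i` are pairwise vertex-disjoint. -/
def PairwiseDisjoint (q : ∀ i, Σ j, Quiver.Path (s i) (t j)) : Prop :=
  ∀ i j, i ≠ j → ∀ v, v ∈ (q i).2.vertices → v ∉ (q j).2.vertices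

/-- The vertices that lie on at least two of the paths `q i`. -/
def sharedVertices (q : ∀ i, Σ j, Quiver.Path (s i) (t j)) : Set V :=
  {v | ∃ i j, i ≠ j ∧ v ∈ (q i).2.vertices ∧ v ∈ (q j).2.vertices}

theorem pairwiseDisjoint_iff {q : ∀ i, Σ j, Quiver.Path (s i) (t j)} :
    PairwiseDisjoint q ↔ sharedVertices q = ∅ := by
  simp only [PairwiseDisjoint, Set.eq_empty_iff_forall_notMem, sharedVertices, Set.mem_ofPred_eq,
    not_exists, not_and]
  exact ⟨fun h v i j hij => h i j hij v, fun h i j hij v => h v i j hij⟩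

section SwapTails

variable [DecidableEq ι] {q : ∀ i, Σ j, Quiver.Path (s i) (t j)} {v : V} {i j : ι}

theorem swapTails_left : swapTails q v i j i = splice (q i) (q j) v := by
  rw [swapTails, Equiv.swap_apply_left]

theorem swapTails_right : swapTails q v i j j = splice (q j) (q i) v := by
  rw [swapTails, Equiv.swap_apply_right]

theorem swapTails_of_ne_of_ne (hV : ∀ (v : V) (p : Quiver.Path v v), p = nil) {k : ι}
    (hi : k ≠ i) (hj : k ≠ j) : swapTails q v i j k = q k := by
  rw [swapTails, Equiv.swap_apply_of_ne_of_ne hi hj, splice_self hV]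

/-- The set of indices of paths through `v` is invariant, so a pair chosen from this set alone is
chosen again after the exchange. -/
theorem mem_swapTails_iff (hV : ∀ (v : V) (p : Quiver.Path v v), p = nil)
    (hi : v ∈ (q i).2.vertices) (hj : v ∈ (q j).2.vertices) (k : ι) :
    v ∈ (swapTails q v i j k).2.vertices ↔ v ∈ (q k).2.vertices := by
  rcases eq_or_ne k i with rfl | hki
  · rw [swapTails_left]
    exact iff_of_true (mem_splice hV hi hj) hi
  rcases eq_or_ne k j with rfl | hkj
  · rw [swapTails_right]
    exact iff_of_true (mem_splice hV hj hi) hj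
  rw [swapTails_of_ne_of_ne hV hki hkj]

theorem swapTails_swapTails (hV : ∀ (v : V) (p : Quiver.Path v v), p = nil)
    (hi : v ∈ (q i).2.vertices) (hj : v ∈ (q j).2.vertices) :
    swapTails (swapTails q v i j) v i j = q := by
  funext k
  rcases eq_or_ne k i with rfl | hki
  · rw [swapTails_left, swapTails_left, swapTails_right, splice_splice hV hi hj]
  rcases eq_or_ne k j with rfl | hkj
  · rw [swapTails_right, swapTails_right, swapTails_left, splice_splice hV hj hi]
  rw [swapTails_of_ne_of_ne hV hki hkj, swapTails_of_ne_of_ne hV hki hkj]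

theorem swapTails_fst (hV : ∀ (v : V) (p : Quiver.Path v v), p = nil)
    (hi : v ∈ (q i).2.vertices) (hj : v ∈ (q j).2.vertices) (k : ι) :
    (swapTails q v i j k).1 = (q (Equiv.swap i j k)).1 := by
  rcases eq_or_ne k i with rfl | hki
  · rw [swapTails_left, splice_fst hV hi hj, Equiv.swap_apply_left]
  rcases eq_or_ne k j with rfl | hkj
  · rw [swapTails_right, splice_fst hV hj hi, Equiv.swap_apply_right]
  rw [swapTails_of_ne_of_ne hV hki hkj, Equiv.swap_apply_of_ne_of_ne hki hkj]

theorem prod_weight_swapTails [Fintype ι] (hV : ∀ (v : V) (p : Quiver.Path v v), p = nil)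
    {R : Type*} [CommMonoid R] (w : ∀ {i j : V}, (i ⟶ j) → R) (hij : i ≠ j)
    (hi : v ∈ (q i).2.vertices) (hj : v ∈ (q j).2.vertices) :
    ∏ k, (swapTails q v i j k).2.weight w = ∏ k, (q k).2.weight w := by
  have hj' : j ∈ Finset.univ.erase i := Finset.mem_erase.2 ⟨hij.symm, Finset.mem_univ j⟩
  rw [← Finset.mul_prod_erase _ _ (Finset.mem_univ i), ← Finset.mul_prod_erase _ _ hj',
    ← Finset.mul_prod_erase (a := i) _ (fun k => (q k).2.weight w) (Finset.mem_univ i),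
    ← Finset.mul_prod_erase _ (fun k => (q k).2.weight w) hj', ← mul_assoc, ← mul_assoc,
    swapTails_left, swapTails_right, weight_splice_mul hV w hi hj]
  congr 1
  refine Finset.prod_congr rfl fun k hk => ?_
  simp only [Finset.mem_erase] at hk
  rw [swapTails_of_ne_of_ne hV hk.2.1 hk.1]

/-- If one of the two paths sharing the vertex is not exchanged, the vertex stays on it and on some
other path. If both are exchanged, `mem_splice_and_mem_splice` applies. -/
theorem sharedVertices_subset_swapTails (hV : ∀ (v : V) (p : Quiver.Path v v), p = nil)
    (hij : i ≠ j) (hi : v ∈ (q i).2.vertices) (hj : v ∈ (q j).2.vertices) :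
    sharedVertices q ⊆ sharedVertices (swapTails q v i j) := by
  have key : ∀ k l w, k ≠ i → k ≠ j → k ≠ l → w ∈ (q k).2.vertices → w ∈ (q l).2.vertices →
      w ∈ sharedVertices (swapTails q v i j) := by
    intro k l w hki hkj hkl hk hl
    rw [← swapTails_of_ne_of_ne (q := q) (v := v) hV hki hkj] at hk
    by_cases hlij : l = i ∨ l = j
    · have : w ∈ (splice (q i) (q j) v).2.vertices ∨ w ∈ (splice (q j) (q i) v).2.vertices := by
        rcases hlij with rfl | rfl
        · exact mem_splice_or_mem_splice hV hi hj hl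
        · exact (mem_splice_or_mem_splice hV hj hi hl).symm
      rw [← swapTails_left, ← swapTails_right] at this
      exact this.elim (fun h => ⟨k, i, hki, hk, h⟩) fun h => ⟨k, j, hkj, hk, h⟩
    · rw [not_or] at hlij
      rw [← swapTails_of_ne_of_ne (q := q) (v := v) hV hlij.1 hlij.2] at hl
      exact ⟨k, l, hkl, hk, hl⟩
  rintro w ⟨k, l, hkl, hk, hl⟩
  by_cases hkij : k ≠ i ∧ k ≠ j
  · exact key k l w hkij.1 hkij.2 hkl hk hl
  by_cases hlij : l ≠ i ∧ l ≠ j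
  · exact key l k w hlij.1 hlij.2 hkl.symm hl hk
  have hw : w ∈ (q i).2.vertices ∧ w ∈ (q j).2.vertices := by
    have hk' : k = i ∨ k = j := by tauto
    have hl' : l = i ∨ l = j := by tauto
    rcases hk' with rfl | rfl <;> rcases hl' with rfl | rfl
    exacts [absurd rfl hkl, ⟨hk, hl⟩, ⟨hl, hk⟩, absurd rfl hkl]
  have h := mem_splice_and_mem_splice hV hi hj hw.1 hw.2
  rw [← swapTails_left, ← swapTails_right] at h
  exact ⟨i, j, hij, h.1, h.2⟩

theorem sharedVertices_swapTails (hV : ∀ (v : V) (p : Quiver.Path v v), p = nil)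
    (hij : i ≠ j) (hi : v ∈ (q i).2.vertices) (hj : v ∈ (q j).2.vertices) :
    sharedVertices (swapTails q v i j) = sharedVertices q := by
  refine (sharedVertices_subset_swapTails hV hij hi hj).antisymm' ?_
  -- The reverse inclusion is the same one for the swapped family, since the exchange is an
  -- involution.
  have := sharedVertices_subset_swapTails hV hij ((mem_swapTails_iff hV hi hj i).2 hi)
    ((mem_swapTails_iff hV hi hj j).2 hj)
  rwa [swapTails_swapTails hV hi hj] at this

end SwapTails

/-! ### The Lindström–Gessel–Viennot lemma -/

/-- The families of paths that are not pairwise disjoint contribute nothing to the determinant. -/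
theorem sum_not_pairwiseDisjoint_eq_zero [DecidableEq ι] [Fintype ι] {t : ι → V}
    [Fintype (∀ i, Σ j, Quiver.Path (s i) (t j))]
    [DecidablePred fun q : ∀ i, Σ j, Quiver.Path (s i) (t j) => ¬ PairwiseDisjoint q]
    (hV : ∀ (v : V) (p : Quiver.Path v v), p = nil) {R : Type*} [CommRing R]
    (w : ∀ {i j : V}, (i ⟶ j) → R) :
    ∑ q : ∀ i, Σ j, Quiver.Path (s i) (t j) with ¬ PairwiseDisjoint q,
      (∏ i, (q i).2.weight w) *
        Matrix.detRowAlternating (R := R) (fun i => Pi.single (q i).1 1) = 0 := by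
  by_cases hbad : ∃ q : ∀ i, Σ j, Quiver.Path (s i) (t j), ¬ PairwiseDisjoint q
  swap
  · push Not at hbad
    rw [Finset.filter_false_of_mem (by simpa using hbad), Finset.sum_empty]
  obtain ⟨q₀, hq₀⟩ := hbad
  rw [pairwiseDisjoint_iff, ← ne_eq, ← Set.nonempty_iff_ne_empty] at hq₀
  obtain ⟨v₀, i₀, j₀, -⟩ := hq₀
  -- The vertex and the pair of indices are chosen as functions of sets that the exchange preserves,
  -- so the second exchange undoes the first. Outside the relevant case the choices take default
  -- values.
  have hf : ∀ S : Set V, ∃ v, S.Nonempty → v ∈ S := fun S => by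
    by_cases h : S.Nonempty
    · exact ⟨h.some, fun _ => h.some_mem⟩
    · exact ⟨v₀, fun h' => absurd h' h⟩
  have hg : ∀ S : Set ι, ∃ ij : ι × ι, S.Nontrivial → ij.1 ∈ S ∧ ij.2 ∈ S ∧ ij.1 ≠ ij.2 :=
    fun S => by
      by_cases h : S.Nontrivial
      · obtain ⟨i, hi, j, hj, hij⟩ := h
        exact ⟨(i, j), fun _ => ⟨hi, hj, hij⟩⟩
      · exact ⟨(i₀, j₀), fun h' => absurd h' h⟩
  choose f hf using hf
  choose g hg using hg
  let vx : (∀ i, Σ j, Quiver.Path (s i) (t j)) → V := fun q => f (sharedVertices q)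
  let ij : (∀ i, Σ j, Quiver.Path (s i) (t j)) → ι × ι :=
    fun q => g {k | vx q ∈ (q k).2.vertices}
  have hmem : ∀ q, ¬ PairwiseDisjoint q → vx q ∈ (q (ij q).1).2.vertices ∧
      vx q ∈ (q (ij q).2).2.vertices ∧ (ij q).1 ≠ (ij q).2 := by
    intro q hq
    rw [pairwiseDisjoint_iff, ← ne_eq, ← Set.nonempty_iff_ne_empty] at hq
    obtain ⟨i, j, hne, hi, hj⟩ := hf _ hq
    exact hg {k | vx q ∈ (q k).2.vertices} ⟨i, hi, j, hj, hne⟩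
  let σ : (∀ i, Σ j, Quiver.Path (s i) (t j)) → ∀ i, Σ j, Quiver.Path (s i) (t j) :=
    fun q => swapTails q (vx q) (ij q).1 (ij q).2
  have hsh : ∀ q, ¬ PairwiseDisjoint q → sharedVertices (σ q) = sharedVertices q := fun q hq =>
    have h := hmem q hq
    sharedVertices_swapTails hV h.2.2 h.1 h.2.1
  have hvx : ∀ q, ¬ PairwiseDisjoint q → vx (σ q) = vx q := fun q hq =>
    congrArg f (hsh q hq)
  have hij : ∀ q, ¬ PairwiseDisjoint q → ij (σ q) = ij q := fun q hq => by
    have h := hmem q hq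
    refine congrArg g (Set.ext fun k => ?_)
    rw [Set.mem_ofPred_eq, Set.mem_ofPred_eq, hvx q hq]
    exact mem_swapTails_iff hV h.1 h.2.1 k
  have hσσ : ∀ q, ¬ PairwiseDisjoint q → σ (σ q) = q := fun q hq => by
    have h := hmem q hq
    have : σ (σ q) = swapTails (σ q) (vx q) (ij q).1 (ij q).2 := by
      rw [← hvx q hq, ← hij q hq]
    rw [this]
    exact swapTails_swapTails hV h.1 h.2.1
  have hneg : ∀ q, ¬ PairwiseDisjoint q →
      Matrix.detRowAlternating (R := R) (fun i => Pi.single (σ q i).1 1) =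
        - Matrix.detRowAlternating (R := R) (fun i => Pi.single (q i).1 1) := fun q hq => by
    have h := hmem q hq
    rw [← AlternatingMap.map_swap _ _ h.2.2]
    congr 1
    funext k
    exact congrArg (fun l => Pi.single (M := fun _ => R) l 1) (swapTails_fst hV h.1 h.2.1 k)
  have hprod : ∀ q, ¬ PairwiseDisjoint q →
      ∏ i, (σ q i).2.weight w = ∏ i, (q i).2.weight w := fun q hq => by
    have h := hmem q hq
    exact prod_weight_swapTails hV w h.2.2 h.1 h.2.1
  refine Finset.sum_involution (fun q _ => σ q) (fun q hq => ?_) (fun q hq h0 heq => h0 ?_)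
    (fun q hq => ?_) (fun q hq => ?_) <;> replace hq := (Finset.mem_filter.1 hq).2
  · rw [hprod q hq, hneg q hq, mul_neg, add_neg_cancel]
  -- A fixed family has two paths with the same sink, so two rows agree and its term already
  -- vanishes.
  · have h := hmem q hq
    have hfst := swapTails_fst hV h.1 h.2.1 (ij q).1
    rw [Equiv.swap_apply_left] at hfst
    replace hfst : (q (ij q).1).1 = (q (ij q).2).1 :=
      (congrArg (fun q' => (q' (ij q).1).1) heq).symm.trans hfst
    have hdet : Matrix.detRowAlternating (R := R) (fun i => Pi.single (q i).1 1) = 0 :=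
      AlternatingMap.map_eq_zero_of_eq _ _
        (congrArg (fun l => Pi.single (M := fun _ => R) l 1) hfst) h.2.2
    rw [hdet, mul_zero]
  · refine Finset.mem_filter.2 ⟨Finset.mem_univ _, ?_⟩
    rwa [pairwiseDisjoint_iff, hsh q hq, ← pairwiseDisjoint_iff]
  · exact hσσ q hq

/-- The Lindström–Gessel–Viennot lemma. -/
theorem det_sum_weight_eq [DecidableEq ι] [Fintype ι] {t : ι → V}
    [∀ i j, Fintype (Quiver.Path (s i) (t j))]
    [DecidablePred fun q : ∀ i, Σ j, Quiver.Path (s i) (t j) => PairwiseDisjoint q]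
    (hV : ∀ (v : V) (p : Quiver.Path v v), p = nil) {R : Type*} [CommRing R]
    (w : ∀ {i j : V}, (i ⟶ j) → R) :
    (Matrix.of fun i j => ∑ p : Quiver.Path (s i) (t j), p.weight w).det =
      ∑ q : ∀ i, Σ j, Quiver.Path (s i) (t j) with PairwiseDisjoint q,
        (∏ i, (q i).2.weight w) *
          Matrix.detRowAlternating (R := R) (fun i => Pi.single (q i).1 1) := by
  -- Each row is a sum, over all paths from its source, of weighted standard basis vectors.
  -- Expanding gives terms for arbitrary choices of sinks, with the determinant as the sign, or `0`
  -- when a sink repeats.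
  have hrow : (Matrix.of fun i j => ∑ p : Quiver.Path (s i) (t j), p.weight w) =
      fun i => ∑ x : Σ j, Quiver.Path (s i) (t j), x.2.weight w • Pi.single x.1 (1 : R) := by
    funext i j
    rw [Finset.sum_apply, Fintype.sum_sigma, Finset.sum_eq_single j]
    · simp
    · intro k _ hk
      simp [Pi.single_eq_of_ne hk.symm]
    · simp
  rw [hrow]
  change Matrix.detRowAlternating.toMultilinearMap _ = _
  rw [MultilinearMap.map_sum, ← Finset.sum_filter_add_sum_filter_not _ PairwiseDisjoint]
  simp_rw [MultilinearMap.map_smul_univ]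
  exact (congrArg _ (sum_not_pairwiseDisjoint_eq_zero hV w)).trans (add_zero _)

/-- The Lindström–Gessel–Viennot lemma in the case where disjoint families of paths exist only
for the identity matching of sources and sinks. -/
theorem det_sum_weight_eq_of_forall_fst_eq [DecidableEq ι] [Fintype ι] {t : ι → V}
    [∀ i j, Fintype (Quiver.Path (s i) (t j))]
    [DecidablePred fun π : ∀ i, Quiver.Path (s i) (t i) =>
      ∀ i j, i ≠ j → ∀ v, v ∈ (π i).vertices → v ∉ (π j).vertices]
    (hV : ∀ (v : V) (p : Quiver.Path v v), p = nil) {R : Type*} [CommRing R]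
    (w : ∀ {i j : V}, (i ⟶ j) → R)
    (hid : ∀ q : ∀ i, Σ j, Quiver.Path (s i) (t j), PairwiseDisjoint q → ∀ i, (q i).1 = i) :
    (Matrix.of fun i j => ∑ p : Quiver.Path (s i) (t j), p.weight w).det =
      ∑ π : ∀ i, Quiver.Path (s i) (t i) with
        ∀ i j, i ≠ j → ∀ v, v ∈ (π i).vertices → v ∉ (π j).vertices, ∏ i, (π i).weight w := by
  classical
  rw [det_sum_weight_eq hV w]
  symm
  refine Finset.sum_bij (fun π _ i => ⟨i, π i⟩) (fun π hπ => ?_) (fun π _ π' _ h => ?_)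
    (fun q hq => ?_) (fun π _ => ?_)
  · exact Finset.mem_filter.2 ⟨Finset.mem_univ _, (Finset.mem_filter.1 hπ).2⟩
  · funext i
    exact eq_of_heq (Sigma.mk.inj (congrFun h i)).2
  · have hq := (Finset.mem_filter.1 hq).2
    have hex : ∀ i, ∃ p : Quiver.Path (s i) (t i), q i = ⟨i, p⟩ := fun i => by
      have h := hid q hq i
      revert h
      generalize q i = x
      obtain ⟨j, p⟩ := x
      intro h
      obtain rfl : j = i := h
      exact ⟨p, rfl⟩
    choose π hπ using hex
    obtain rfl : q = fun i => ⟨i, π i⟩ := funext hπ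
    exact ⟨π, Finset.mem_filter.2 ⟨Finset.mem_univ _, hq⟩, rfl⟩
  · have : Matrix.detRowAlternating (R := R) (fun i : ι => Pi.single i (1 : R)) = 1 := by
      refine (congrArg Matrix.det ?_).trans (Matrix.det_one (n := ι) (R := R))
      funext i j
      exact Matrix.one_eq_pi_single.symm
    dsimp only
    rw [this, mul_one]

end Quiver.Path

/-! ### Planar networks and their principal minors -/

/-- In a drawing, a path of the network is drawn as a curve, all points of which are vertices of
the path or points of an edge between vertices of the path. -/
theorem StripDrawing.exists_curve {V : Type*} [Quiver V] {n : ℕ} {s t : Fin n → V} (D : StripDrawing V s t) {u v : V}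
    (p : Quiver.Path u v) :
    ∃ γ : Path (D.pos u) (D.pos v), ∀ x, (∃ w ∈ p.vertices, γ x = D.pos w) ∨
      ∃ (e : Quiver.Total V) (y : unitInterval), e.left ∈ p.vertices ∧ e.right ∈ p.vertices ∧
        γ x = D.arc e y := by
  induction p with
  | nil => exact ⟨Path.refl _, fun x => Or.inl ⟨u, by simp, rfl⟩⟩
  | @cons b c p e ih =>
    obtain ⟨γ, hγ⟩ := ih
    refine ⟨γ.trans (D.arc ⟨b, c, e⟩), fun x => ?_⟩
    have hx : γ.trans (D.arc ⟨b, c, e⟩) x ∈ Set.range γ ∪ Set.range (D.arc ⟨b, c, e⟩) := by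
      rw [← Path.trans_range]
      exact Set.mem_range_self x
    simp only [Quiver.Path.mem_vertices_cons]
    rcases hx with ⟨y, hy⟩ | ⟨y, hy⟩
    · rw [← hy]
      rcases hγ y with ⟨w, hw, h⟩ | ⟨f, z, hl, hr, h⟩
      · exact Or.inl ⟨w, Or.inl hw, h⟩
      · exact Or.inr ⟨f, z, Or.inl hl, Or.inl hr, h⟩
    · exact Or.inr ⟨⟨b, c, e⟩, y, Or.inl p.end_mem_vertices, Or.inr rfl, hy.symm⟩

/-- A principal minor, indexed by a subtype. -/
theorem minor_self_eq_det_subtype {n : ℕ} (A : Matrix (Fin n) (Fin n) ℝ) (I : Finset (Fin n))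
    {P : Fin n → Prop} [DecidablePred P] (hP : ∀ i, P i ↔ i ∈ I) :
    minor A I I rfl = (A.submatrix (Subtype.val : Subtype P → Fin n) Subtype.val).det := by
  let e : Fin I.card ≃ Subtype P :=
    (I.orderIsoOfFin rfl).toEquiv.trans (Equiv.subtypeEquivRight fun i => (hP i).symm)
  rw [← Matrix.det_submatrix_equiv_self e, Matrix.submatrix_submatrix]
  rfl

namespace PlanarNetwork

variable {V : Type*} [Quiver V] {n : ℕ}

/-- In a planar network, two paths that connect two sources to two sinks in the opposite order have
a common vertex. -/
theorem exists_common_vertex (G : PlanarNetwork V n) {i j k l : Fin n} (hij : i < j) (hkl : k < l)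
    (p : Quiver.Path (G.source i) (G.sink l)) (q : Quiver.Path (G.source j) (G.sink k)) :
    ∃ v, v ∈ p.vertices ∧ v ∈ q.vertices := by
  obtain ⟨D⟩ := G.planar
  obtain ⟨γ, hγ⟩ := D.exists_curve p
  obtain ⟨δ, hδ⟩ := D.exists_curve q
  have hγs : ∀ x, (γ x).1 ∈ Set.Icc (0 : ℝ) 1 := fun x => by
    rcases hγ x with ⟨w, -, h⟩ | ⟨e, y, -, -, h⟩ <;> rw [h]
    exacts [D.pos_mem_strip w, D.arc_mem_strip e y]
  have hδs : ∀ x, (δ x).1 ∈ Set.Icc (0 : ℝ) 1 := fun x => by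
    rcases hδ x with ⟨w, -, h⟩ | ⟨e, y, -, -, h⟩ <;> rw [h]
    exacts [D.pos_mem_strip w, D.arc_mem_strip e y]
  obtain ⟨x, y, hxy⟩ := γ.exists_eq_of_crossing δ hγs hδs (D.source_left i) (D.source_left j)
    (D.sink_right l) (D.sink_right k) (D.source_order i j hij) (D.sink_order k l hkl)
  -- a vertex that lies on an edge is an endpoint of that edge
  have hend : ∀ (e : Quiver.Total V) z v, D.arc e z = D.pos v → v = e.left ∨ v = e.right := by
    intro e z v h
    rcases D.arc_eq_pos e z v h with rfl | rfl
    · exact Or.inl (D.pos_injective (by rw [← h, Path.source]))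
    · exact Or.inr (D.pos_injective (by rw [← h, Path.target]))
  rcases hγ x with ⟨v, hv, h⟩ | ⟨e, z, hl, hr, h⟩ <;>
    rcases hδ y with ⟨v', hv', h'⟩ | ⟨e', z', hl', hr', h'⟩ <;> rw [h, h'] at hxy
  · obtain rfl := D.pos_injective hxy
    exact ⟨v, hv, hv'⟩
  · rcases hend e' z' v hxy.symm with rfl | rfl
    exacts [⟨_, hv, hl'⟩, ⟨_, hv, hr'⟩]
  · rcases hend e z v' hxy with rfl | rfl
    exacts [⟨_, hl, hv'⟩, ⟨_, hr, hv'⟩]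
  · by_cases hee : e = e'
    · subst hee
      exact ⟨_, hl, hl'⟩
    obtain ⟨v, hv⟩ := D.arc_inter e e' hee z z' hxy
    have h₁ : v ∈ p.vertices := by
      rcases hend e z v hv with rfl | rfl
      exacts [hl, hr]
    have h₂ : v ∈ q.vertices := by
      rcases hend e' z' v (hxy ▸ hv) with rfl | rfl
      exacts [hl', hr']
    exact ⟨v, h₁, h₂⟩

/-- In a planar network, pairwise disjoint paths with sources and sinks indexed by the same set
connect sources to sinks with the same index. -/
theorem fst_eq_of_pairwiseDisjoint (G : PlanarNetwork V n) {P : Fin n → Prop}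
    (q : ∀ i : Subtype P, Σ j : Subtype P, Quiver.Path (G.source i) (G.sink j))
    (hq : Quiver.Path.PairwiseDisjoint (s := fun i : Subtype P => G.source i)
      (t := fun j : Subtype P => G.sink j) q) (i : Subtype P) : (q i).1 = i := by
  have hmono : StrictMono fun i => (q i).1 := by
    intro i j hij
    by_contra! hle
    rcases hle.eq_or_lt with h | h
    · refine hq i j hij.ne (G.sink (q i).1) (Quiver.Path.end_mem_vertices _) ?_
      rw [← h]
      exact Quiver.Path.end_mem_vertices _
    · obtain ⟨v, h₁, h₂⟩ := G.exists_common_vertex hij h (q i).2 (q j).2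
      exact hq i j hij.ne v h₁ h₂
  -- A strictly increasing self-map of a finite linear order is the identity.
  exact le_antisymm hmono.apply_le hmono.le_apply

variable [Finite V] [∀ u v : V, Finite (u ⟶ v)]

/-- A principal minor of the weight matrix of a planar network is the sum of the weights of the
families of disjoint paths that connect the corresponding sources and sinks. -/
theorem minor_weightMatrix_self (G : PlanarNetwork V n) (I : Finset (Fin n)) {P : Fin n → Prop}
    [DecidablePred P] (hP : ∀ i, P i ↔ i ∈ I) :
    minor G.weightMatrix I I rfl =
      ∑ᶠ (π : ∀ i : Subtype P, Quiver.Path (G.source i) (G.sink i))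
        (_ : ∀ i j, i ≠ j → ∀ v, v ∈ (π i).vertices → v ∉ (π j).vertices),
        ∏ i, G.pathWeight (π i) := by
  classical
  have := G.finite_path
  have : ∀ u v : V, Fintype (Quiver.Path u v) := fun u v => Fintype.ofFinite _
  have hdet := Quiver.Path.det_sum_weight_eq_of_forall_fst_eq
    (s := fun i : Subtype P => G.source i) (t := fun j : Subtype P => G.sink j) G.acyclic
    G.edgeWeight G.fst_eq_of_pairwiseDisjoint
  rw [minor_self_eq_det_subtype _ I hP]
  simp_rw [finsum_eq_if, finsum_eq_sum_of_fintype]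
  rw [← Finset.sum_filter]
  refine Eq.trans (congrArg Matrix.det ?_) hdet
  ext i j
  exact finsum_eq_sum_of_fintype _

end PlanarNetwork

/-! ### The product of complementary minors -/

theorem mainTheorem4 {V : Type*} [Quiver V] [Finite V] [∀ u v : V, Finite (u ⟶ v)] {n : ℕ}
    (A : Matrix (Fin n) (Fin n) ℝ) (hA : IsTotallyNonneg A)
    (G : PlanarNetwork V n) (hG : G.weightMatrix = A) (I : Finset (Fin n)) :
    minor A I I rfl * minor A Iᶜ Iᶜ rfl =
      ∑ᶠ (π : G.PathFamily) (_ : G.DisjointOn π I ∧ G.DisjointOn π Iᶜ), G.familyWeight π := by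
  classical
  subst hG
  have := G.finite_path
  have : ∀ u v : V, Fintype (Quiver.Path u v) := fun u v => Fintype.ofFinite _
  -- The complement is described by `¬ i ∈ I` to match the second factor of
  -- `Equiv.piEquivPiSubtypeProd`.
  rw [G.minor_weightMatrix_self I (P := (· ∈ I)) (fun _ => Iff.rfl),
    G.minor_weightMatrix_self Iᶜ (P := fun i => ¬ i ∈ I) (fun _ => Finset.mem_compl.symm)]
  simp_rw [finsum_eq_if, finsum_eq_sum_of_fintype]
  rw [Finset.sum_mul_sum, ← Fintype.sum_prod_type']
  symm
  refine Fintype.sum_equiv (Equiv.piEquivPiSubtypeProd (· ∈ I) _) _ _ fun π => ?_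
  rw [ite_zero_mul_ite_zero]
  have hI : ∀ (J : Finset (Fin n)) (P : Fin n → Prop), (∀ i, P i ↔ i ∈ J) →
      (G.DisjointOn π J ↔ ∀ i j : Subtype P, i ≠ j →
        ∀ v, v ∈ (π i).vertices → v ∉ (π j).vertices) := by
    intro J P hP
    refine ⟨fun h i j hij => h i ((hP i).1 i.2) j ((hP j).1 j.2) (Subtype.coe_injective.ne hij),
      fun h i hi j hj hij => h ⟨i, (hP i).2 hi⟩ ⟨j, (hP j).2 hj⟩ fun h' => hij ?_⟩
    exact congrArg Subtype.val h'
  refine if_congr (and_congr (hI I _ fun _ => Iff.rfl)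
    (hI Iᶜ _ fun _ => Finset.mem_compl.symm)) ?_ rfl
  exact (Fintype.prod_subtype_mul_prod_subtype (· ∈ I) fun i => G.pathWeight (π i)).symm
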